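/- Let $X$ be a real normed space of dimension at least $2$, and for $x,y\in X$ let $$\rho_{\pm}(x,y)=\lim_{t\to 0^{\pm}}\frac{\|x+ty\|^2-\|x\|^2}{2t}$$ (these limits always exist). Write $x\perp_{\rho_*}y$ if $\rho_-(x,y)\,\rho_+(x,y)=0$. Let $Y$ be a real Banach space, let $\varepsilon\in\mathbb{R}$, and let $f:X\to Y$ be a mapping such that $$x\perp_{\rho_*}y\ \Longrightarrow\ \|f(x+y)-f(x)-f(y)\|\le\varepsilon\qquad(x,y\in X).$$ Then there exist exactly one additive mapping $A:X\to Y$ (that is, $A(x+y)=A(x)+A(y)$ for all $x,y\in X$) and exactly one quadratic mapping $Q:X\to Y$ (that is, $Q(x+y)+Q(x-y)=2Q(x)+2Q(y)$ for all $x,y\in X$) such that $$\|f(x)-f(0)-A(x)-Q(x)\|\le\frac{68}{3}\,\varepsilon\qquad(x\in X).$$ -/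

import Mathlib

open Filter Topology

noncomputable section

namespace RhoStar

variable {X : Type*} [NormedAddCommGroup X] [NormedSpace ℝ X]

/-- The right norm derivative `ρ₊(x, y) = lim_{t → 0⁺} (‖x + t y‖² - ‖x‖²) / (2t)`. -/
def rhoPlus (x y : X) : ℝ :=
  limUnder (𝓝[>] (0 : ℝ)) (fun t : ℝ => (‖x + t • y‖ ^ 2 - ‖x‖ ^ 2) / (2 * t))

/-- The left norm derivative `ρ₋(x, y) = lim_{t → 0⁻} (‖x + t y‖² - ‖x‖²) / (2t)`. -/
def rhoMinus (x y : X) : ℝ :=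
  limUnder (𝓝[<] (0 : ℝ)) (fun t : ℝ => (‖x + t • y‖ ^ 2 - ‖x‖ ^ 2) / (2 * t))

lemma convexOn_norm_line (x y : X) :
    ConvexOn ℝ Set.univ (fun t : ℝ => ‖x + t • y‖) := by
  refine ⟨convex_univ, fun a _ b _ p q hp hq hpq => ?_⟩
  have h : x + (p • a + q • b) • y = p • (x + a • y) + q • (x + b • y) := by
    have hx : x = (p + q) • x := by rw [hpq, one_smul]
    nth_rewrite 1 [hx]
    simp only [smul_eq_mul]
    module
  calc ‖x + (p • a + q • b) • y‖ = ‖p • (x + a • y) + q • (x + b • y)‖ := by rw [h]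
    _ ≤ ‖p • (x + a • y)‖ + ‖q • (x + b • y)‖ := norm_add_le _ _
    _ = p • ‖x + a • y‖ + q • ‖x + b • y‖ := by
      rw [norm_smul, norm_smul, Real.norm_of_nonneg hp, Real.norm_of_nonneg hq]; rfl

/-- The limit defining `ρ₊` exists. -/
lemma tendsto_rhoPlus (x y : X) :
    Tendsto (fun t : ℝ => (‖x + t • y‖ ^ 2 - ‖x‖ ^ 2) / (2 * t)) (𝓝[>] (0 : ℝ))
      (𝓝 (rhoPlus x y)) := by
  have hd := ((convexOn_norm_line x y).differentiableWithinAt_Ioi_of_mem_interior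
    (x := 0) (by simp)).pow 2 |>.hasDerivWithinAt
  rw [hasDerivWithinAt_iff_tendsto_slope' (by simp)] at hd
  refine tendsto_nhds_limUnder ⟨_, (hd.div_const 2).congr fun t => ?_⟩
  simp only [slope_def_field, Pi.pow_apply, zero_smul, add_zero, sub_zero]
  rw [div_div, mul_comm]

/-- The limit defining `ρ₋` exists. -/
lemma tendsto_rhoMinus (x y : X) :
    Tendsto (fun t : ℝ => (‖x + t • y‖ ^ 2 - ‖x‖ ^ 2) / (2 * t)) (𝓝[<] (0 : ℝ))
      (𝓝 (rhoMinus x y)) := by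
  have hd := ((convexOn_norm_line x y).differentiableWithinAt_Iio_of_mem_interior
    (x := 0) (by simp)).pow 2 |>.hasDerivWithinAt
  rw [hasDerivWithinAt_iff_tendsto_slope' (by simp)] at hd
  refine tendsto_nhds_limUnder ⟨_, (hd.div_const 2).congr fun t => ?_⟩
  simp only [slope_def_field, Pi.pow_apply, zero_smul, add_zero, sub_zero]
  rw [div_div, mul_comm]

/-- `ρ_*(x, y) = ρ₋(x, y) ρ₊(x, y)`. -/
def rhoStar (x y : X) : ℝ := rhoMinus x y * rhoPlus x y

/-- `x` is `ρ_*`-orthogonal to `y`. -/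
def Orth (x y : X) : Prop := rhoStar x y = 0

/-- Additive mappings (no continuity or homogeneity is required). -/
def IsAdditive {E Y : Type*} [AddCommGroup E] [AddCommGroup Y] (A : E → Y) : Prop :=
  ∀ x y : E, A (x + y) = A x + A y

/-- Quadratic mappings: `Q (x + y) + Q (x - y) = 2 Q x + 2 Q y`. -/
def IsQuadratic {E Y : Type*} [AddCommGroup E] [AddCommGroup Y] (Q : E → Y) : Prop :=
  ∀ x y : E, Q (x + y) + Q (x - y) = 2 • Q x + 2 • Q y

end RhoStar

end

noncomputable section

namespace RhoStar

section

variable {X : Type*} [NormedAddCommGroup X] [NormedSpace ℝ X]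

/-! ### Elementary properties of the norm derivatives -/

/-! Fix `x ≠ 0`, a nonzero `w` with `x ⊥ w`, and `c > 0`. Minimising `t ^ (-c/(1+c)) * ‖x + t w‖`
over `t > 0` traps the scaled norm between the two norm derivatives at `z = x + t w`. If one of the
bounds is attained, then `z ⊥ c x - t w`, a splitting of `(1 + c) x`; if neither is, the norm has a
corner at `z`. Running this along `w` and `-w` gives the dichotomy `exists_orth_or_corners`.

At a corner, two different directions `u` and `u - d z` are both orthogonal to `z`, which makes `f`
nearly additive under translation by multiples of `z`; two corners on opposite sides of `x` span the
plane, so `f` is nearly additive there (`near_additive_plane`, error `18 ε`). A splitting with `c =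
1` gives instead `f(2x) ≈ 2 f(x)` for the odd part and `f(2x) ≈ 4 f(x)` for the even part, and
Hyers' iteration has total error `3 ε + 5 ε + ε = 9 ε`. Both errors are below `68/3 ε`.

The limits `A` and `Q` are exactly orthogonally additive. The dichotomy with arbitrary `c`, applied
to them, yields the additive and quadratic identities on lines, and an orthogonal basis extends
these to all pairs. Uniqueness holds because a bounded map multiplied by 2 or 4 under doubling
vanishes. -/

lemma rhoPlus_eq {x y : X} {l : ℝ}
    (h : Tendsto (fun t : ℝ => (‖x + t • y‖ ^ 2 - ‖x‖ ^ 2) / (2 * t)) (𝓝[>] (0 : ℝ)) (𝓝 l)) :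
    rhoPlus x y = l :=
  tendsto_nhds_unique (tendsto_rhoPlus x y) h

lemma rhoMinus_eq {x y : X} {l : ℝ}
    (h : Tendsto (fun t : ℝ => (‖x + t • y‖ ^ 2 - ‖x‖ ^ 2) / (2 * t)) (𝓝[<] (0 : ℝ)) (𝓝 l)) :
    rhoMinus x y = l :=
  tendsto_nhds_unique (tendsto_rhoMinus x y) h

lemma tendsto_mul_Ioi {c : ℝ} (hc : 0 < c) :
    Tendsto (fun t : ℝ => c * t) (𝓝[>] 0) (𝓝[>] 0) := by
  refine tendsto_nhdsWithin_iff.2 ⟨?_, ?_⟩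
  · have : Tendsto (fun t : ℝ => c * t) (𝓝 0) (𝓝 (c * 0)) := (continuous_const_mul c).tendsto 0
    rw [mul_zero] at this
    exact this.mono_left nhdsWithin_le_nhds
  · filter_upwards [self_mem_nhdsWithin] with t ht using mul_pos hc ht

lemma tendsto_neg_Ioi : Tendsto (fun t : ℝ => -t) (𝓝[>] 0) (𝓝[<] 0) := by
  simpa using tendsto_neg_nhdsGT (a := (0 : ℝ))

lemma rhoPlus_neg_right (x y : X) : rhoPlus x (-y) = -rhoMinus x y := by
  refine rhoPlus_eq ((((tendsto_rhoMinus x y).comp tendsto_neg_Ioi).neg).congr fun t => ?_)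
  simp only [Function.comp, neg_smul, smul_neg, mul_neg, div_neg, neg_neg]

lemma rhoPlus_neg_left (x y : X) : rhoPlus (-x) y = -rhoMinus x y := by
  rw [← rhoPlus_neg_right]
  refine rhoPlus_eq ((tendsto_rhoPlus x (-y)).congr fun t => ?_)
  rw [norm_neg, ← norm_neg (x + t • -y)]
  congr 4
  simp only [smul_neg]
  abel

lemma rhoMinus_eq_neg (x y : X) : rhoMinus x y = -rhoPlus x (-y) := by
  rw [rhoPlus_neg_right, neg_neg]

lemma rhoPlus_smul_right (x y : X) {c : ℝ} (hc : 0 < c) :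
    rhoPlus x (c • y) = c * rhoPlus x y := by
  refine rhoPlus_eq ((((tendsto_rhoPlus x y).comp (tendsto_mul_Ioi hc)).const_mul c).congr'
    ?_)
  filter_upwards [self_mem_nhdsWithin] with t ht
  have ht' : t ≠ 0 := ne_of_gt ht
  simp only [Function.comp, smul_smul, mul_comm c t]
  field_simp

lemma rhoPlus_smul_left (x y : X) {c : ℝ} (hc : 0 < c) :
    rhoPlus (c • x) y = c * rhoPlus x y := by
  refine rhoPlus_eq ((((tendsto_rhoPlus x y).comp
    (tendsto_mul_Ioi (inv_pos.2 hc))).const_mul c).congr' ?_)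
  filter_upwards [self_mem_nhdsWithin] with t ht
  have ht' : t ≠ 0 := ne_of_gt ht
  have h : c • x + t • y = c • (x + (c⁻¹ * t) • y) := by
    rw [smul_add, smul_smul, mul_inv_cancel_left₀ hc.ne']
  simp only [Function.comp, h, norm_smul, Real.norm_of_nonneg hc.le]
  field_simp

lemma tendsto_div_one_add_mul (s : ℝ) :
    Tendsto (fun t : ℝ => t / (1 + t * s)) (𝓝[>] 0) (𝓝[>] 0) := by
  have h1 : Tendsto (fun t : ℝ => 1 + t * s) (𝓝 0) (𝓝 1) := by
    have : Continuous fun t : ℝ => 1 + t * s := by fun_prop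
    simpa using this.tendsto 0
  refine tendsto_nhdsWithin_iff.2 ⟨?_, ?_⟩
  · have := (tendsto_id (α := ℝ) (x := 𝓝 0)).div h1 one_ne_zero
    simp only [zero_div] at this
    exact this.mono_left nhdsWithin_le_nhds
  · filter_upwards [self_mem_nhdsWithin,
      nhdsWithin_le_nhds (h1.eventually (lt_mem_nhds zero_lt_one))] with t ht h
    exact div_pos ht h

/-- Factor `x + t(s x + y) = (1 + t s)(x + t/(1 + t s) y)` and reparametrise the limit by `t/(1 + t
s)`. -/
lemma rhoPlus_smul_add (x y : X) (s : ℝ) :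
    rhoPlus x (s • x + y) = s * ‖x‖ ^ 2 + rhoPlus x y := by
  have h1 : Tendsto (fun t : ℝ => 1 + t * s) (𝓝[>] 0) (𝓝 1) := by
    have : Continuous fun t : ℝ => 1 + t * s := by fun_prop
    exact Tendsto.mono_left (by simpa using this.tendsto 0) nhdsWithin_le_nhds
  have h2 : Tendsto (fun t : ℝ => (s + t * s ^ 2 / 2) * ‖x‖ ^ 2) (𝓝[>] 0)
      (𝓝 (s * ‖x‖ ^ 2)) := by
    have : Continuous fun t : ℝ => (s + t * s ^ 2 / 2) * ‖x‖ ^ 2 := by fun_prop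
    exact Tendsto.mono_left (by simpa using this.tendsto 0) nhdsWithin_le_nhds
  have h3 := h2.add (h1.mul ((tendsto_rhoPlus x y).comp (tendsto_div_one_add_mul s)))
  rw [one_mul] at h3
  refine rhoPlus_eq (h3.congr' ?_)
  filter_upwards [self_mem_nhdsWithin, h1.eventually (lt_mem_nhds zero_lt_one)] with t ht h
  have ht' : t ≠ 0 := ne_of_gt ht
  have hz : x + t • (s • x + y) = (1 + t * s) • (x + (t / (1 + t * s)) • y) := by
    rw [smul_add (1 + t * s), smul_smul (1 + t * s), mul_div_cancel₀ _ h.ne']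
    module
  simp only [Function.comp, hz, norm_smul, Real.norm_of_nonneg h.le]
  field_simp
  ring

lemma rhoMinus_smul_add (x y : X) (s : ℝ) :
    rhoMinus x (s • x + y) = s * ‖x‖ ^ 2 + rhoMinus x y := by
  rw [rhoMinus_eq_neg, neg_add, ← neg_smul, rhoPlus_smul_add, rhoMinus_eq_neg x y]
  ring

lemma rhoMinus_smul_right (x y : X) {c : ℝ} (hc : 0 < c) :
    rhoMinus x (c • y) = c * rhoMinus x y := by
  rw [rhoMinus_eq_neg, ← smul_neg, rhoPlus_smul_right _ _ hc, rhoMinus_eq_neg x y]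
  ring

lemma rhoMinus_smul_left (x y : X) {c : ℝ} (hc : 0 < c) :
    rhoMinus (c • x) y = c * rhoMinus x y := by
  rw [rhoMinus_eq_neg, rhoPlus_smul_left _ _ hc, rhoMinus_eq_neg x y]
  ring

lemma rhoPlus_zero_right (x : X) : rhoPlus x 0 = 0 :=
  rhoPlus_eq (tendsto_const_nhds.congr fun t => by simp)

lemma rhoPlus_zero_left (y : X) : rhoPlus 0 y = 0 := by
  have : rhoPlus (0 : X) y = 2 * rhoPlus (0 : X) y := by
    simpa using rhoPlus_smul_left (0 : X) y two_pos
  linarith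

lemma rhoMinus_zero_left (y : X) : rhoMinus 0 y = 0 := by
  rw [rhoMinus_eq_neg, rhoPlus_zero_left, neg_zero]

/-! ### `ρ_*`-orthogonality -/

lemma orth_iff {x y : X} : Orth x y ↔ rhoMinus x y = 0 ∨ rhoPlus x y = 0 := mul_eq_zero

lemma orth_zero_left (y : X) : Orth 0 y := orth_iff.2 (Or.inr (rhoPlus_zero_left y))

lemma orth_zero_right (x : X) : Orth x 0 := orth_iff.2 (Or.inr (rhoPlus_zero_right x))

/-- Negation exchanges `ρ₋` and `ρ₊` up to sign, so the vanishing of their product survives; this is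
what makes the relation homogeneous for all real scalars. -/
lemma Orth.neg_right {x y : X} (h : Orth x y) : Orth x (-y) := by
  rw [orth_iff, rhoPlus_neg_right, rhoMinus_eq_neg, neg_neg, neg_eq_zero, neg_eq_zero]
  exact (orth_iff.1 h).symm

lemma Orth.neg_left {x y : X} (h : Orth x y) : Orth (-x) y := by
  rw [orth_iff, rhoPlus_neg_left, rhoMinus_eq_neg, rhoPlus_neg_left, rhoMinus_eq_neg x (-y),
    neg_neg, neg_neg, neg_eq_zero, neg_eq_zero]
  exact (orth_iff.1 h).symm

lemma Orth.smul_right {x y : X} (h : Orth x y) (c : ℝ) : Orth x (c • y) := by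
  have key : ∀ {c : ℝ}, 0 < c → Orth x (c • y) := fun hc => by
    rw [orth_iff, rhoPlus_smul_right _ _ hc, rhoMinus_smul_right _ _ hc]
    exact (orth_iff.1 h).imp (fun h => by rw [h, mul_zero]) (fun h => by rw [h, mul_zero])
  rcases lt_trichotomy c 0 with hc | rfl | hc
  · simpa using (key (neg_pos.2 hc)).neg_right
  · simpa using orth_zero_right x
  · exact key hc

lemma Orth.smul_left {x y : X} (h : Orth x y) (c : ℝ) : Orth (c • x) y := by
  have key : ∀ {c : ℝ}, 0 < c → Orth (c • x) y := fun hc => by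
    rw [orth_iff, rhoPlus_smul_left _ _ hc, rhoMinus_smul_left _ _ hc]
    exact (orth_iff.1 h).imp (fun h => by rw [h, mul_zero]) (fun h => by rw [h, mul_zero])
  rcases lt_trichotomy c 0 with hc | rfl | hc
  · simpa using (key (neg_pos.2 hc)).neg_left
  · simpa using orth_zero_left y
  · exact key hc

lemma Orth.smul {x y : X} (h : Orth x y) (a b : ℝ) : Orth (a • x) (b • y) :=
  (h.smul_left a).smul_right b

lemma orth_sub_rhoPlus {x : X} (hx : x ≠ 0) (v : X) :
    Orth x (v - (rhoPlus x v / ‖x‖ ^ 2) • x) := by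
  have : ‖x‖ ^ 2 ≠ 0 := by positivity
  refine orth_iff.2 (Or.inr ?_)
  rw [sub_eq_neg_add, ← neg_smul, rhoPlus_smul_add]
  field_simp
  ring

lemma orth_sub_rhoMinus {x : X} (hx : x ≠ 0) (v : X) :
    Orth x (v - (rhoMinus x v / ‖x‖ ^ 2) • x) := by
  have : ‖x‖ ^ 2 ≠ 0 := by positivity
  refine orth_iff.2 (Or.inl ?_)
  rw [sub_eq_neg_add, ← neg_smul, rhoMinus_smul_add]
  field_simp
  ring

lemma exists_orth_basis (hX : 2 ≤ Module.rank ℝ X) {x : X} (hx : x ≠ 0) (b : X) :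
    ∃ w : X, w ≠ 0 ∧ Orth x w ∧ ∃ β γ : ℝ, b = β • x + γ • w := by
  have key : ∀ v : X, (∀ r : ℝ, v ≠ r • x) →
      ∃ w : X, w ≠ 0 ∧ Orth x w ∧ ∃ β γ : ℝ, v = β • x + γ • w := fun v hv =>
    ⟨v - (rhoPlus x v / ‖x‖ ^ 2) • x, sub_ne_zero.2 (hv _), orth_sub_rhoPlus hx v,
      rhoPlus x v / ‖x‖ ^ 2, 1, by rw [one_smul]; abel⟩
  by_cases hb : ∃ r : ℝ, b = r • x
  -- For `b` on the line of `x`, the dimension hypothesis supplies a vector off that line from which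
  -- to build `w`.
  · obtain ⟨r, rfl⟩ := hb
    obtain ⟨v, hv⟩ : ∃ v : X, ∀ r : ℝ, v ≠ r • x := by
      by_contra! h
      have h1 : Module.rank ℝ X ≤ 1 := rank_le_one_iff.2 ⟨x, fun v =>
        let ⟨r, hr⟩ := h v; ⟨r, hr.symm⟩⟩
      exact absurd (hX.trans h1) (by norm_num)
    obtain ⟨w, hw, hxw, -⟩ := key v hv
    exact ⟨w, hw, hxw, r, 0, by simp⟩
  · push Not at hb
    exact key b hb

/-! ### Orthogonal splittings and corners of the norm -/

/-- The norm is not differentiable at `z` in the direction `v`. -/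
def Corner (z v : X) : Prop := rhoMinus z v ≠ rhoPlus z v

/-- This is `t ^ (-μ) * ‖x + t w‖` with `t = exp s`. It is coercive: the `x` term blows up at `-∞`,
the `w` term at `+∞`, and in each case the other term tends to zero. -/
lemma exists_min_exp {x w : X} (hx : x ≠ 0) (hw : w ≠ 0) {μ : ℝ} (h0 : 0 < μ) (h1 : μ < 1) :
    ∃ s : ℝ, ∀ r : ℝ, ‖Real.exp (-μ * s) • x + Real.exp ((1 - μ) * s) • w‖ ≤
      ‖Real.exp (-μ * r) • x + Real.exp ((1 - μ) * r) • w‖ := by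
  have hc : Continuous fun r : ℝ => ‖Real.exp (-μ * r) • x + Real.exp ((1 - μ) * r) • w‖ := by
    fun_prop
  refine hc.exists_forall_le ?_
  have e1 : ∀ r : ℝ, ‖Real.exp (-μ * r) • x‖ = Real.exp (-μ * r) * ‖x‖ := fun r => by
    rw [norm_smul, Real.norm_of_nonneg (Real.exp_pos _).le]
  have e2 : ∀ r : ℝ, ‖Real.exp ((1 - μ) * r) • w‖ = Real.exp ((1 - μ) * r) * ‖w‖ := fun r => by
    rw [norm_smul, Real.norm_of_nonneg (Real.exp_pos _).le]
  rw [cocompact_eq_atBot_atTop, tendsto_sup]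
  constructor
  · have t1 : Tendsto (fun r : ℝ => Real.exp (-μ * r) * ‖x‖) atBot atTop :=
      (Real.tendsto_exp_atTop.comp
        (tendsto_id.const_mul_atBot_of_neg (neg_lt_zero.2 h0))).atTop_mul_const (norm_pos_iff.2 hx)
    have t2 : Tendsto (fun r : ℝ => -(Real.exp ((1 - μ) * r) * ‖w‖)) atBot (𝓝 (-(0 * ‖w‖))) :=
      ((Real.tendsto_exp_atBot.comp (tendsto_id.const_mul_atBot (sub_pos.2 h1))).mul_const _).neg
    refine tendsto_atTop_mono (fun r => ?_) (t1.atTop_add t2)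
    have := norm_sub_le (Real.exp (-μ * r) • x + Real.exp ((1 - μ) * r) • w)
      (Real.exp ((1 - μ) * r) • w)
    rw [add_sub_cancel_right, e1, e2] at this
    linarith
  · have t1 : Tendsto (fun r : ℝ => Real.exp ((1 - μ) * r) * ‖w‖) atTop atTop :=
      (Real.tendsto_exp_atTop.comp (tendsto_id.const_mul_atTop (sub_pos.2 h1))).atTop_mul_const
        (norm_pos_iff.2 hw)
    have t2 : Tendsto (fun r : ℝ => -(Real.exp (-μ * r) * ‖x‖)) atTop (𝓝 (-(0 * ‖x‖))) :=
      ((Real.tendsto_exp_atBot.comp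
        (tendsto_id.const_mul_atTop_of_neg (neg_lt_zero.2 h0))).mul_const _).neg
    refine tendsto_atTop_mono (fun r => ?_) (t1.atTop_add t2)
    have := norm_sub_le (Real.exp (-μ * r) • x + Real.exp ((1 - μ) * r) • w)
      (Real.exp (-μ * r) • x)
    rw [add_sub_cancel_left, e1, e2] at this
    linarith

/-- A minimiser of `t ↦ t ^ (-μ) * ‖x + t w‖` on the positive half-line. -/
lemma exists_min_norm_mul {x w : X} (hx : x ≠ 0) (hw : w ≠ 0) {μ : ℝ} (h0 : 0 < μ)
    (h1 : μ < 1) :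
    ∃ t : ℝ, 0 < t ∧ ∀ r : ℝ, 0 < t + r →
      ‖x + t • w‖ ^ 2 * Real.exp (2 * μ * Real.log (1 + r / t)) ≤ ‖x + t • w + r • w‖ ^ 2 := by
  obtain ⟨s, hs⟩ := exists_min_exp hx hw h0 h1
  have e : ∀ r : ℝ, ‖Real.exp (-μ * r) • x + Real.exp ((1 - μ) * r) • w‖ =
      Real.exp (-μ * r) * ‖x + Real.exp r • w‖ := fun r => by
    rw [← Real.norm_of_nonneg (Real.exp_pos (-μ * r)).le, ← norm_smul,
      Real.norm_of_nonneg (Real.exp_pos (-μ * r)).le, smul_add, smul_smul, ← Real.exp_add]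
    ring_nf
  refine ⟨Real.exp s, Real.exp_pos s, fun r hr => ?_⟩
  have h := hs (Real.log (Real.exp s + r))
  rw [e, e, Real.exp_log hr] at h
  have hlog : Real.log (1 + r / Real.exp s) = Real.log (Real.exp s + r) - s := by
    rw [← div_self (Real.exp_pos s).ne', ← add_div, Real.log_div hr.ne' (Real.exp_pos s).ne',
      Real.log_exp]
  have h' : ‖x + Real.exp s • w‖ * Real.exp (μ * Real.log (1 + r / Real.exp s)) ≤
      ‖x + Real.exp s • w + r • w‖ := by
    rw [add_assoc, ← add_smul]
    have := mul_le_mul_of_nonneg_left h (Real.exp_pos (μ * Real.log (Real.exp s + r))).le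
    rw [← mul_assoc, ← mul_assoc, ← Real.exp_add, ← Real.exp_add] at this
    rw [show μ * Real.log (Real.exp s + r) + -μ * Real.log (Real.exp s + r) = 0 by ring,
      show μ * Real.log (Real.exp s + r) + -μ * s = μ * (Real.log (Real.exp s + r) - s) by ring,
      Real.exp_zero, one_mul] at this
    rwa [hlog, mul_comm]
  have h2 := pow_le_pow_left₀ (by positivity) h' 2
  rwa [mul_pow, ← Real.exp_nat_mul, Nat.cast_ofNat, ← mul_assoc] at h2

/-- First-order conditions at the minimiser: a smooth minorant touches `r ↦ ‖z + r w‖ ^ 2` at `r =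
0`, so its slope lies between the one-sided slopes. -/
lemma exists_rho_bounds {x w : X} (hx : x ≠ 0) (hw : w ≠ 0) {μ : ℝ} (h0 : 0 < μ)
    (h1 : μ < 1) :
    ∃ t : ℝ, 0 < t ∧ t * rhoMinus (x + t • w) w ≤ μ * ‖x + t • w‖ ^ 2 ∧
      μ * ‖x + t • w‖ ^ 2 ≤ t * rhoPlus (x + t • w) w := by
  obtain ⟨t, ht, h⟩ := exists_min_norm_mul hx hw h0 h1
  set z := x + t • w
  have hd : HasDerivAt (fun r : ℝ => ‖z‖ ^ 2 * Real.exp (2 * μ * Real.log (1 + r / t)))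
      (‖z‖ ^ 2 * (2 * μ / t)) 0 := by
    have h1 : HasDerivAt (fun r : ℝ => 1 + r / t) (1 / t) 0 :=
      ((hasDerivAt_id (0 : ℝ)).div_const t).const_add 1
    have h2 := (((h1.log (by simp)).const_mul (2 * μ)).exp).const_mul (‖z‖ ^ 2)
    refine h2.congr_deriv ?_
    rw [zero_div, add_zero, Real.log_one, mul_zero, Real.exp_zero]
    ring
  have hμ : t * (‖z‖ ^ 2 * (2 * μ / t) / 2) = μ * ‖z‖ ^ 2 := by field_simp
  have hpos : ∀ᶠ r in 𝓝 (0 : ℝ), 0 < t + r := by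
    have : Continuous fun r : ℝ => t + r := by fun_prop
    exact this.continuousAt.eventually (lt_mem_nhds (by simpa using ht))
  refine ⟨t, ht, ?_, ?_⟩
  · have hs := (hasDerivWithinAt_iff_tendsto_slope' (by simp)).1
      (hd.hasDerivWithinAt (s := Set.Iio 0))
    have hle := le_of_tendsto_of_tendsto (tendsto_rhoMinus z w) (hs.div_const 2) (by
      filter_upwards [self_mem_nhdsWithin, nhdsWithin_le_nhds hpos] with r hr hr'
      simp only [slope_def_field]
      rw [div_div, mul_comm 2 r, sub_zero]
      refine div_le_div_of_nonpos_of_le (by simp at hr; linarith) ?_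
      have := h r hr'
      simp
      linarith)
    have := mul_le_mul_of_nonneg_left hle ht.le
    rwa [hμ] at this
  · have hs := (hasDerivWithinAt_iff_tendsto_slope' (by simp)).1
      (hd.hasDerivWithinAt (s := Set.Ioi 0))
    have hle := le_of_tendsto_of_tendsto (hs.div_const 2) (tendsto_rhoPlus z w) (by
      filter_upwards [self_mem_nhdsWithin, nhdsWithin_le_nhds hpos] with r hr hr'
      simp only [slope_def_field]
      rw [div_div, mul_comm 2 r, sub_zero]
      refine div_le_div_of_nonneg_right ?_ (by simp at hr; linarith)
      have := h r hr'
      simp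
      linarith)
    have := mul_le_mul_of_nonneg_left hle ht.le
    rwa [hμ] at this

lemma exists_orth_or_corner {x w : X} (hx : x ≠ 0) (hw : w ≠ 0) {c : ℝ} (hc : 0 < c) :
    ∃ t : ℝ, 0 < t ∧ (Orth (x + t • w) (c • x - t • w) ∨ Corner (x + t • w) w) := by
  have hc1 : 0 < 1 + c := by linarith
  -- This `μ` makes `-μ z + t w` proportional to `c x - t w`.
  obtain ⟨t, ht, h1, h2⟩ := exists_rho_bounds hx hw (μ := c / (1 + c)) (by positivity)
    ((div_lt_one hc1).2 (by linarith))
  refine ⟨t, ht, ?_⟩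
  set z := x + t • w with hz
  have hv : c • x - t • w = (-(1 + c)) • ((-(c / (1 + c))) • z + t • w) := by
    rw [hz, smul_add, smul_smul, neg_mul_neg, mul_div_cancel₀ _ hc1.ne']
    module
  rcases h1.lt_or_eq with h1 | h1
  · rcases h2.lt_or_eq with h2 | h2
    · exact Or.inr (lt_of_mul_lt_mul_left (h1.trans h2) ht.le).ne
    · left
      rw [hv]
      refine Orth.smul_right (orth_iff.2 (Or.inr ?_)) _
      rw [rhoPlus_smul_add, rhoPlus_smul_right _ _ ht]
      linarith
  · left
    rw [hv]
    refine Orth.smul_right (orth_iff.2 (Or.inl ?_)) _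
    rw [rhoMinus_smul_add, rhoMinus_smul_right _ _ ht]
    linarith

lemma Corner.of_neg_right {z v : X} (h : Corner z (-v)) : Corner z v := by
  intro heq
  apply h
  rw [rhoPlus_neg_right, rhoMinus_eq_neg, neg_neg, heq]

/-- Either `x` splits orthogonally along `w` with ratio `c`, or the norm has corners on both
sides of `x` on the line through `x` in the direction `w`. -/
lemma exists_orth_or_corners {x w : X} (hx : x ≠ 0) (hw : w ≠ 0) {c : ℝ} (hc : 0 < c) :
    (∃ t : ℝ, Orth (x + t • w) (c • x - t • w)) ∨
      ∃ t t' : ℝ, 0 < t ∧ 0 < t' ∧ Corner (x + t • w) w ∧ Corner (x - t' • w) w := by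
  obtain ⟨t, ht, h | h⟩ := exists_orth_or_corner hx hw hc
  · exact Or.inl ⟨t, h⟩
  obtain ⟨t', ht', h' | h'⟩ := exists_orth_or_corner hx (neg_ne_zero.2 hw) hc
  · exact Or.inl ⟨-t', by simpa using h'⟩
  · refine Or.inr ⟨t, t', ht, ht', h, ?_⟩
    simpa [sub_eq_add_neg] using h'.of_neg_right

end

section

variable {X Y : Type*} [NormedAddCommGroup X] [NormedSpace ℝ X]
  [NormedAddCommGroup Y]

/-! ### Approximately orthogonally additive mappings -/

/-- `f` is orthogonally additive up to an error `ε`. -/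
def NearOrthAdditive (ε : ℝ) (f : X → Y) : Prop :=
  ∀ x y : X, Orth x y → ‖f (x + y) - f x - f y‖ ≤ ε

variable {f : X → Y} {ε : ℝ}

lemma NearOrthAdditive.norm_zero_le (hf : NearOrthAdditive ε f) : ‖f 0‖ ≤ ε := by
  simpa using hf 0 0 (orth_zero_left 0)

lemma NearOrthAdditive.nonneg (hf : NearOrthAdditive ε f) : 0 ≤ ε :=
  (norm_nonneg _).trans hf.norm_zero_le

lemma Corner.exists_orth {z v : X} (h : Corner z v) :
    ∃ (u : X) (d p : ℝ), d ≠ 0 ∧ Orth z u ∧ Orth z (u - d • z) ∧ v = u + p • z := by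
  have hz : z ≠ 0 := by
    rintro rfl
    exact h (by rw [rhoPlus_zero_left, rhoMinus_zero_left])
  have hz2 : ‖z‖ ^ 2 ≠ 0 := by positivity
  refine ⟨v - (rhoMinus z v / ‖z‖ ^ 2) • z, rhoPlus z v / ‖z‖ ^ 2 - rhoMinus z v / ‖z‖ ^ 2,
    rhoMinus z v / ‖z‖ ^ 2, ?_, orth_sub_rhoMinus hz v, ?_, by abel⟩
  · rw [← sub_div]
    exact div_ne_zero (sub_ne_zero.2 (Ne.symm h)) hz2
  · convert orth_sub_rhoPlus hz v using 1
    module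

/-- Writing one vector as `a z + q (u - d z) = (a + r) z + q u` with `q = -r/d` shows that `f((a +
r) z) - f(a z)` is within `2 ε` of a quantity independent of `a`; compare `a = s` with `a = 0`. -/
lemma NearOrthAdditive.near_additive_line (hf : NearOrthAdditive ε f) {z u : X} {d : ℝ}
    (hd : d ≠ 0) (h₁ : Orth z u) (h₂ : Orth z (u - d • z)) (s r : ℝ) :
    ‖f ((s + r) • z) - f (s • z) - f (r • z) + f 0‖ ≤ 4 * ε := by
  have key : ∀ a : ℝ, ‖f ((a + r) • z) - f (a • z) -
      (f ((-r / d) • (u - d • z)) - f ((-r / d) • u))‖ ≤ ε + ε := fun a => by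
    have e₁ := hf _ _ (h₂.smul a (-r / d))
    have e₂ := hf _ _ (h₁.smul (a + r) (-r / d))
    have e : a • z + (-r / d) • (u - d • z) = (a + r) • z + (-r / d) • u := by
      rw [smul_sub, smul_smul, div_mul_cancel₀ _ hd]
      module
    rw [e] at e₁
    refine (le_of_eq (congrArg norm ?_)).trans (norm_sub_le_of_le e₁ e₂)
    abel
  have h₀ := key 0
  rw [zero_add, zero_smul] at h₀
  refine (le_of_eq (congrArg norm ?_)).trans
    ((norm_sub_le_of_le (key s) h₀).trans (by linarith))
  abel

lemma NearOrthAdditive.near_additive_corner (hf : NearOrthAdditive ε f) {z v : X}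
    (h : Corner z v) (a b s : ℝ) :
    ‖f (a • z + b • v + s • z) - f (a • z + b • v) - f (s • z) + f 0‖ ≤ 6 * ε := by
  obtain ⟨u, d, p, hd, h₁, h₂, rfl⟩ := h.exists_orth
  have e₁ := hf _ _ (h₁.smul (a + b * p + s) b)
  have e₂ := hf _ _ (h₁.smul (a + b * p) b)
  have e₃ := hf.near_additive_line hd h₁ h₂ (a + b * p) s
  rw [show a • z + b • (u + p • z) + s • z = (a + b * p + s) • z + b • u by module,
    show a • z + b • (u + p • z) = (a + b * p) • z + b • u by module]
  refine (le_of_eq (congrArg norm ?_)).trans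
    ((norm_add_le_of_le (norm_sub_le_of_le e₁ e₂) e₃).trans (by linarith))
  abel

/-- Two corners on the line through `x` in the direction `w` force `f` to be approximately
additive on the plane spanned by `x` and `w`. -/
lemma NearOrthAdditive.near_additive_plane (hf : NearOrthAdditive ε f) {x w : X} {t t' : ℝ}
    (ht : 0 < t) (ht' : 0 < t') (h : Corner (x + t • w) w) (h' : Corner (x - t' • w) w)
    (a b c e : ℝ) :
    ‖f (a • x + b • w + (c • x + e • w)) - f (a • x + b • w) - f (c • x + e • w) + f 0‖ ≤
      18 * ε := by
  have g : ∀ a b s : ℝ, ‖f (a • x + b • w + s • (x + t • w)) - f (a • x + b • w) -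
      f (s • (x + t • w)) + f 0‖ ≤ 6 * ε := fun a b s => by
    have := hf.near_additive_corner h a (b - a * t) s
    rwa [show a • (x + t • w) + (b - a * t) • w = a • x + b • w by module] at this
  have g' : ∀ a b s : ℝ, ‖f (a • x + b • w + s • (x - t' • w)) - f (a • x + b • w) -
      f (s • (x - t' • w)) + f 0‖ ≤ 6 * ε := fun a b s => by
    have := hf.near_additive_corner h' a (b + a * t') s
    rwa [show a • (x - t' • w) + (b + a * t') • w = a • x + b • w by module] at this
  -- Coordinates of `c x + e w` in the basis of the two corner points, independent since `t + t' >
  -- 0`.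
  obtain ⟨α, β, hα, hβ⟩ : ∃ α β : ℝ, α + β = c ∧ α * t - β * t' = e :=
    ⟨(e + c * t') / (t + t'), (c * t - e) / (t + t'), by field_simp; ring, by field_simp; ring⟩
  have e₁ := g a b α
  have e₂ := g' (a + α) (b + α * t) β
  have e₃ := g' α (α * t) β
  rw [show a • x + b • w + α • (x + t • w) = (a + α) • x + (b + α * t) • w by module] at e₁
  rw [show (a + α) • x + (b + α * t) • w + β • (x - t' • w) =
    a • x + b • w + (c • x + e • w) by rw [← hα, ← hβ]; module] at e₂
  rw [show α • x + (α * t) • w + β • (x - t' • w) = c • x + e • w by rw [← hα, ← hβ]; module,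
    show α • x + (α * t) • w = α • (x + t • w) by module] at e₃
  refine (le_of_eq (congrArg norm ?_)).trans
    ((norm_sub_le_of_le (norm_add_le_of_le e₁ e₂) e₃).trans (by linarith))
  abel

/-! ### Exact orthogonal additivity -/

/-- Along each line, either all the splittings needed are available, or the mapping is additive
on a plane containing the line. -/
lemma NearOrthAdditive.split_or_additive {F : X → Y} (hF : NearOrthAdditive 0 F) {x w : X}
    (hx : x ≠ 0) (hw : w ≠ 0) {c : ℝ} (hc : 0 < c) :
    (∃ t : ℝ, Orth (x + t • w) (c • x - t • w)) ∨
      ∀ a b : ℝ, F ((a + b) • x) = F (a • x) + F (b • x) := by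
  rcases exists_orth_or_corners hx hw hc with h | ⟨t, t', ht, ht', h, h'⟩
  · exact Or.inl h
  · refine Or.inr fun a b => ?_
    have h0 : F 0 = 0 := by simpa using hF.norm_zero_le
    have := hF.near_additive_plane ht ht' h h' a 0 b 0
    simp only [zero_smul, add_zero, mul_zero, norm_le_zero_iff, h0, ← add_smul] at this
    rw [sub_sub, sub_eq_zero] at this
    exact this

lemma NearOrthAdditive.map_add {F : X → Y} (hF : NearOrthAdditive 0 F) {x y : X}
    (h : Orth x y) : F (x + y) = F x + F y := by
  have := hF x y h
  rwa [norm_le_zero_iff, sub_sub, sub_eq_zero] at this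

variable [NormedSpace ℝ Y]

/-- The sum and the difference of the orthogonal pair `x + t w`, `c x - t w` are expanded along `x ⊥
w`; oddness and doubling cancel the `w` terms. The difference covers negative `b`. -/
lemma additive_line_of_odd {A : X → Y} (hA : NearOrthAdditive 0 A)
    (hodd : ∀ x, A (-x) = -A x) (h2 : ∀ x, A ((2 : ℝ) • x) = (2 : ℝ) • A x) {x w : X}
    (hx : x ≠ 0) (hw : w ≠ 0) (hxw : Orth x w) (b : ℝ) :
    A ((1 + b) • x) = A x + A (b • x) := by
  have h0 : A 0 = 0 := by simpa using hA.norm_zero_le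
  have key : ∀ c : ℝ, 0 < c → A ((1 + c) • x) = A x + A (c • x) ∧
      A ((1 - c) • x) = A x - A (c • x) := fun c hc => by
    rcases hA.split_or_additive hx hw hc with ⟨t, h⟩ | h
    · have e₁ := hA.map_add (hxw.smul 1 t)
      have e₂ := hA.map_add (hxw.smul c (-t))
      have e₃ := hA.map_add h
      have e₄ := hA.map_add (h.neg_right)
      have e₅ := hA.map_add (hxw.smul (1 - c) (2 * t))
      rw [show x + t • w + (c • x - t • w) = (1 + c) • x by module] at e₃
      rw [show x + t • w + -(c • x - t • w) = (1 - c) • x + (2 * t) • w by module, e₅,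
        mul_smul, h2, hodd] at e₄
      rw [one_smul] at e₁
      rw [neg_smul, ← sub_eq_add_neg, hodd] at e₂
      rw [e₁, e₂] at e₃ e₄
      refine ⟨by rw [e₃]; abel, ?_⟩
      rw [two_smul] at e₄
      rw [← add_left_inj (A (t • w) + A (t • w)), e₄]
      abel
    · refine ⟨by rw [h, one_smul], ?_⟩
      rw [sub_eq_add_neg, h, one_smul, neg_smul, hodd, sub_eq_add_neg]
  rcases lt_trichotomy b 0 with hb | rfl | hb
  · have := (key (-b) (neg_pos.2 hb)).2
    rwa [neg_smul, hodd, sub_neg_eq_add, sub_neg_eq_add] at this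
  · simp [h0]
  · exact (key b hb).1

lemma quadratic_line_of_even {Q : X → Y} (hQ : NearOrthAdditive 0 Q)
    (heven : ∀ x, Q (-x) = Q x) (h4 : ∀ x, Q ((2 : ℝ) • x) = (4 : ℝ) • Q x) {x w : X}
    (hx : x ≠ 0) (hw : w ≠ 0) (hxw : Orth x w) (b : ℝ) :
    Q ((1 + b) • x) + Q ((1 - b) • x) = (2 : ℝ) • Q x + (2 : ℝ) • Q (b • x) := by
  have h0 : Q 0 = 0 := by simpa using hQ.norm_zero_le
  have key : ∀ c : ℝ, 0 < c → Q ((1 + c) • x) + Q ((1 - c) • x) =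
      (2 : ℝ) • Q x + (2 : ℝ) • Q (c • x) := fun c hc => by
    rcases hQ.split_or_additive hx hw hc with ⟨t, h⟩ | h
    · have e₁ := hQ.map_add (hxw.smul 1 t)
      have e₂ := hQ.map_add (hxw.smul c (-t))
      have e₃ := hQ.map_add h
      have e₄ := hQ.map_add (h.neg_right)
      have e₅ := hQ.map_add (hxw.smul (1 - c) (2 * t))
      rw [show x + t • w + (c • x - t • w) = (1 + c) • x by module] at e₃
      rw [show x + t • w + -(c • x - t • w) = (1 - c) • x + (2 * t) • w by module, e₅,
        mul_smul, h4, heven] at e₄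
      rw [one_smul] at e₁
      rw [neg_smul, ← sub_eq_add_neg, heven] at e₂
      rw [e₁, e₂] at e₃ e₄
      rw [e₃, eq_sub_of_add_eq e₄]
      module
    -- An even map that is additive on a line vanishes there.
    · have hz : ∀ a : ℝ, Q (a • x) = 0 := fun a => by
        have := h a (-a)
        rw [add_neg_cancel, zero_smul, h0, neg_smul, heven, ← two_smul ℝ] at this
        exact (smul_eq_zero.1 this.symm).resolve_left two_ne_zero
      have := hz 1
      rw [one_smul] at this
      simp [hz, this]
  rcases lt_trichotomy b 0 with hb | rfl | hb
  · have := key (-b) (neg_pos.2 hb)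
    rwa [neg_smul, heven, sub_neg_eq_add, ← sub_eq_add_neg, add_comm] at this
  · simp [h0, two_smul]
  · exact key b hb

lemma isAdditive_of_odd (hX : 2 ≤ Module.rank ℝ X) {A : X → Y} (hA : NearOrthAdditive 0 A)
    (hodd : ∀ x, A (-x) = -A x) (h2 : ∀ x, A ((2 : ℝ) • x) = (2 : ℝ) • A x) :
    IsAdditive A := by
  intro a b
  have h0 : A 0 = 0 := by simpa using hA.norm_zero_le
  rcases eq_or_ne a 0 with rfl | ha
  · simp [h0]
  obtain ⟨w, hw, haw, β, γ, rfl⟩ := exists_orth_basis hX ha b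
  rw [show a + (β • a + γ • w) = (1 + β) • a + γ • w by module, hA.map_add (haw.smul _ _),
    hA.map_add (haw.smul _ _), additive_line_of_odd hA hodd h2 ha hw haw, add_assoc]

lemma isQuadratic_of_even (hX : 2 ≤ Module.rank ℝ X) {Q : X → Y} (hQ : NearOrthAdditive 0 Q)
    (heven : ∀ x, Q (-x) = Q x) (h4 : ∀ x, Q ((2 : ℝ) • x) = (4 : ℝ) • Q x) :
    IsQuadratic Q := by
  intro a b
  have h0 : Q 0 = 0 := by simpa using hQ.norm_zero_le
  rcases eq_or_ne a 0 with rfl | ha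
  · simp [h0, heven, two_smul]
  obtain ⟨w, hw, haw, β, γ, rfl⟩ := exists_orth_basis hX ha b
  have hl := quadratic_line_of_even hQ heven h4 ha hw haw β
  rw [show a + (β • a + γ • w) = (1 + β) • a + γ • w by module,
    show a - (β • a + γ • w) = (1 - β) • a + (-γ) • w by module, hQ.map_add (haw.smul _ _),
    hQ.map_add (haw.smul _ _), hQ.map_add (haw.smul _ _), neg_smul, heven,
    add_add_add_comm, hl]
  module

end

/-! ### Odd and even parts, additive and quadratic mappings -/

section Algebraic

variable {X Y : Type*} [AddCommGroup X] [AddCommGroup Y]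

lemma IsAdditive.map_zero {A : X → Y} (hA : IsAdditive A) : A 0 = 0 := by
  simpa using hA 0 0

lemma IsAdditive.map_neg {A : X → Y} (hA : IsAdditive A) (x : X) : A (-x) = -A x := by
  have := hA x (-x)
  rw [add_neg_cancel, hA.map_zero] at this
  exact (neg_eq_of_add_eq_zero_right this.symm).symm

variable [Module ℝ Y]

lemma IsQuadratic.map_zero {Q : X → Y} (hQ : IsQuadratic Q) : Q 0 = 0 := by
  have := hQ 0 0
  rw [add_zero, sub_zero, ← two_smul ℕ, left_eq_add, ← Nat.cast_smul_eq_nsmul ℝ] at this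
  exact (smul_eq_zero.1 this).resolve_left (by norm_num)

lemma IsQuadratic.map_neg {Q : X → Y} (hQ : IsQuadratic Q) (x : X) : Q (-x) = Q x := by
  have := hQ 0 x
  rw [zero_add, zero_sub, hQ.map_zero, smul_zero, zero_add, two_smul] at this
  exact add_left_cancel this

/-- The odd part of a mapping. -/
def oddPart (f : X → Y) (x : X) : Y := (2⁻¹ : ℝ) • (f x - f (-x))

/-- The even part of a mapping. -/
def evenPart (f : X → Y) (x : X) : Y := (2⁻¹ : ℝ) • (f x + f (-x))

lemma oddPart_neg (f : X → Y) (x : X) : oddPart f (-x) = -oddPart f x := by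
  simp only [oddPart, neg_neg]
  module

lemma evenPart_neg (f : X → Y) (x : X) : evenPart f (-x) = evenPart f x := by
  simp only [evenPart, neg_neg, add_comm]

lemma oddPart_add_evenPart (f : X → Y) (x : X) : oddPart f x + evenPart f x = f x := by
  simp only [oddPart, evenPart]
  module

end Algebraic

variable {X Y : Type*} [NormedAddCommGroup X] [NormedAddCommGroup Y] [NormedSpace ℝ Y]

/-! ### Uniqueness -/

lemma eq_zero_of_bounded {F : X → Y} {k C : ℝ} (hk : 1 < k) (h : ∀ x, F (x + x) = k • F x)
    (hb : ∀ x, ‖F x‖ ≤ C) (x : X) : F x = 0 := by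
  have hC : ∀ n : ℕ, ∀ x, k ^ n * ‖F x‖ ≤ C := fun n => by
    induction n with
    | zero => simpa using hb
    | succ n ih =>
      intro x
      have := ih (x + x)
      rwa [h, norm_smul, Real.norm_of_nonneg (by linarith), ← mul_assoc, ← pow_succ] at this
  by_contra hx
  obtain ⟨n, hn⟩ := pow_unbounded_of_one_lt (C / ‖F x‖) hk
  rw [div_lt_iff₀ (norm_pos_iff.2 hx)] at hn
  exact absurd (hC n x) (not_le.2 hn)

lemma additive_quadratic_unique {g A A' Q Q' : X → Y} {C : ℝ} (hA : IsAdditive A)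
    (hA' : IsAdditive A') (hQ : IsQuadratic Q) (hQ' : IsQuadratic Q')
    (h : ∀ x, ‖g x - A x - Q x‖ ≤ C) (h' : ∀ x, ‖g x - A' x - Q' x‖ ≤ C) :
    A = A' ∧ Q = Q' := by
  have hs : ∀ x, ‖(A x - A' x) + (Q x - Q' x)‖ ≤ C + C := fun x => by
    refine (le_of_eq (congrArg norm ?_)).trans (norm_sub_le_of_le (h' x) (h x))
    abel
  -- Evaluating at `-x` flips only the additive difference, so the two differences can be bounded
  -- separately.
  have hs' : ∀ x, ‖-(A x - A' x) + (Q x - Q' x)‖ ≤ C + C := fun x => by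
    have := hs (-x)
    rwa [hA.map_neg, hA'.map_neg, hQ.map_neg, hQ'.map_neg, ← neg_sub_neg, neg_sub_neg,
      show -A x - -A' x = -(A x - A' x) by abel] at this
  have hn : ∀ x, ‖A x - A' x‖ ≤ C + C ∧ ‖Q x - Q' x‖ ≤ C + C := fun x => by
    have e₁ : A x - A' x = (2⁻¹ : ℝ) • (((A x - A' x) + (Q x - Q' x)) -
      (-(A x - A' x) + (Q x - Q' x))) := by module
    have e₂ : Q x - Q' x = (2⁻¹ : ℝ) • (((A x - A' x) + (Q x - Q' x)) +
      (-(A x - A' x) + (Q x - Q' x))) := by module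
    constructor
    · rw [e₁, norm_smul, Real.norm_of_nonneg (by norm_num)]
      linarith [norm_sub_le_of_le (hs x) (hs' x)]
    · rw [e₂, norm_smul, Real.norm_of_nonneg (by norm_num)]
      linarith [norm_add_le_of_le (hs x) (hs' x)]
  constructor
  · funext x
    refine sub_eq_zero.1 (eq_zero_of_bounded (F := fun x => A x - A' x) one_lt_two
      (fun x => ?_) (fun x => (hn x).1) x)
    rw [hA, hA']
    module
  · funext x
    refine sub_eq_zero.1 (eq_zero_of_bounded (F := fun x => Q x - Q' x) (k := 4) (by norm_num)
      (fun x => ?_) (fun x => (hn x).2) x)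
    have e := hQ x x
    have e' := hQ' x x
    rw [sub_self, hQ.map_zero, add_zero] at e
    rw [sub_self, hQ'.map_zero, add_zero] at e'
    rw [e, e']
    module

/-! ### Stability -/

variable [NormedSpace ℝ X] {f : X → Y} {ε : ℝ}

/-- Hyers' direct method: the rescaled terms have geometrically decaying increments, whose sum is `C
/ (k - 1)`. -/
lemma exists_tendsto_of_near_mul [CompleteSpace Y] {k C : ℝ} (hk : 1 < k) {a : ℕ → Y}
    (h : ∀ n, ‖a (n + 1) - k • a n‖ ≤ C) :
    ∃ L : Y, Tendsto (fun n => (k ^ n)⁻¹ • a n) atTop (𝓝 L) ∧ ‖a 0 - L‖ ≤ C / (k - 1) := by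
  have hk0 : 0 < k := one_pos.trans hk
  have hk1 : k⁻¹ < 1 := inv_lt_one_of_one_lt₀ hk
  have hd : ∀ n, dist ((k ^ n)⁻¹ • a n) ((k ^ (n + 1))⁻¹ • a (n + 1)) ≤ C / k * k⁻¹ ^ n :=
    fun n => by
    have e : (k ^ (n + 1))⁻¹ • a (n + 1) - (k ^ n)⁻¹ • a n =
        (k ^ (n + 1))⁻¹ • (a (n + 1) - k • a n) := by
      rw [smul_sub, smul_smul, pow_succ, mul_inv, inv_mul_cancel_right₀ hk0.ne']
    rw [dist_comm, dist_eq_norm, e, norm_smul, Real.norm_of_nonneg (by positivity)]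
    calc (k ^ (n + 1))⁻¹ * ‖a (n + 1) - k • a n‖ ≤ (k ^ (n + 1))⁻¹ * C :=
          mul_le_mul_of_nonneg_left (h n) (by positivity)
      _ = C / k * k⁻¹ ^ n := by rw [pow_succ, mul_inv, inv_pow]; ring
  obtain ⟨L, hL⟩ := cauchySeq_tendsto_of_complete (cauchySeq_of_le_geometric _ _ hk1 hd)
  refine ⟨L, hL, ?_⟩
  have := dist_le_of_le_geometric_of_tendsto₀ _ _ hk1 hd hL
  rw [dist_eq_norm, pow_zero, inv_one, one_smul] at this
  refine this.trans (le_of_eq ?_)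
  have : k - 1 ≠ 0 := by linarith
  field_simp

lemma NearOrthAdditive.oddPart (hf : NearOrthAdditive ε f) :
    NearOrthAdditive ε (oddPart f) := fun x y h => by
  have e : RhoStar.oddPart f (x + y) - RhoStar.oddPart f x - RhoStar.oddPart f y =
      (2⁻¹ : ℝ) • ((f (x + y) - f x - f y) - (f (-x + -y) - f (-x) - f (-y))) := by
    simp only [RhoStar.oddPart, neg_add]
    module
  rw [e, norm_smul, Real.norm_of_nonneg (by norm_num)]
  linarith [norm_sub_le_of_le (hf x y h) (hf (-x) (-y) h.neg_left.neg_right)]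

lemma NearOrthAdditive.evenPart (hf : NearOrthAdditive ε f) :
    NearOrthAdditive ε (evenPart f) := fun x y h => by
  have e : RhoStar.evenPart f (x + y) - RhoStar.evenPart f x - RhoStar.evenPart f y =
      (2⁻¹ : ℝ) • ((f (x + y) - f x - f y) + (f (-x + -y) - f (-x) - f (-y))) := by
    simp only [RhoStar.evenPart, neg_add]
    module
  rw [e, norm_smul, Real.norm_of_nonneg (by norm_num)]
  linarith [norm_add_le_of_le (hf x y h) (hf (-x) (-y) h.neg_left.neg_right)]

lemma NearOrthAdditive.near_double (hf : NearOrthAdditive ε f) {x y : X} (h : Orth x y)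
    (h' : Orth (x + y) (x - y)) :
    ‖f ((2 : ℝ) • x) - (2 : ℝ) • f x - f y - f (-y)‖ ≤ 3 * ε := by
  have e₁ := hf _ _ h'
  have e₂ := hf _ _ h
  have e₃ := hf _ _ h.neg_right
  rw [show x + y + (x - y) = (2 : ℝ) • x by module] at e₁
  rw [← sub_eq_add_neg] at e₃
  refine (le_of_eq (congrArg norm ?_)).trans
    ((norm_add_le_of_le (norm_add_le_of_le e₁ e₂) e₃).trans (by linarith))
  module

lemma NearOrthAdditive.near_double_of_odd (hf : NearOrthAdditive ε f)
    (hodd : ∀ x, f (-x) = -f x) {x y : X} (h : Orth x y) (h' : Orth (x + y) (x - y)) :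
    ‖f ((2 : ℝ) • x) - (2 : ℝ) • f x‖ ≤ 3 * ε := by
  simpa [hodd] using hf.near_double h h'

lemma NearOrthAdditive.near_double_eq_of_even (hf : NearOrthAdditive ε f)
    (heven : ∀ x, f (-x) = f x) {x y : X} (h : Orth x y) (h' : Orth (x + y) (x - y)) :
    ‖f ((2 : ℝ) • x) - f ((2 : ℝ) • y)‖ ≤ 6 * ε := by
  have e₁ := hf.near_double h h'
  have e₂ := hf _ _ h'.neg_right
  have e₃ := hf _ _ h
  have e₄ := hf _ _ h.neg_right
  rw [show x + y + -(x - y) = (2 : ℝ) • y by module, heven] at e₂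
  rw [← sub_eq_add_neg] at e₄
  refine (le_of_eq (congrArg norm ?_)).trans
    ((norm_sub_le_of_le e₁ (norm_add_le_of_le (norm_add_le_of_le e₂ e₃) e₄)).trans
      (by linarith))
  module

/-- Evenness gives `f(2x) ≈ 2 f(x) + 2 f(y)` within `3 ε`, and the halved pair gives `f(x) ≈ f(y)`
within `6 ε`, counted twice. -/
lemma NearOrthAdditive.near_quadruple_of_even (hf : NearOrthAdditive ε f)
    (heven : ∀ x, f (-x) = f x) {x y : X} (h : Orth x y) (h' : Orth (x + y) (x - y)) :
    ‖f ((2 : ℝ) • x) - (4 : ℝ) • f x‖ ≤ 15 * ε := by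
  have e₁ := hf.near_double h h'
  have e₂ := hf.near_double_eq_of_even heven (h.smul (2⁻¹ : ℝ) (2⁻¹ : ℝ))
    (by rw [← smul_add, ← smul_sub]; exact h'.smul _ _)
  rw [smul_inv_smul₀ two_ne_zero, smul_inv_smul₀ two_ne_zero] at e₂
  rw [heven] at e₁
  refine (le_of_eq (congrArg norm ?_)).trans
    ((norm_sub_le_of_le e₁ (norm_add_le_of_le e₂ e₂)).trans (by linarith))
  module

lemma NearOrthAdditive.exists_tendsto_of_orth [CompleteSpace Y] (hf : NearOrthAdditive ε f)
    {x y : X} (h : Orth x y) (h' : Orth (x + y) (x - y)) :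
    ∃ L M : Y, Tendsto (fun n : ℕ => ((2 : ℝ) ^ n)⁻¹ • RhoStar.oddPart f ((2 : ℝ) ^ n • x))
        atTop (𝓝 L) ∧
      Tendsto (fun n : ℕ => ((4 : ℝ) ^ n)⁻¹ • RhoStar.evenPart f ((2 : ℝ) ^ n • x))
        atTop (𝓝 M) ∧ ‖f x - f 0 - L - M‖ ≤ 68 / 3 * ε := by
  have hs : ∀ n : ℕ, Orth ((2 : ℝ) ^ n • x) ((2 : ℝ) ^ n • y) ∧
      Orth ((2 : ℝ) ^ n • x + (2 : ℝ) ^ n • y) ((2 : ℝ) ^ n • x - (2 : ℝ) ^ n • y) := fun n =>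
    ⟨h.smul _ _, by rw [← smul_add, ← smul_sub]; exact h'.smul _ _⟩
  obtain ⟨L, hL, hL'⟩ := exists_tendsto_of_near_mul one_lt_two
    (a := fun n => RhoStar.oddPart f ((2 : ℝ) ^ n • x)) (C := 3 * ε) fun n => by
      rw [pow_succ', mul_smul]
      exact hf.oddPart.near_double_of_odd (oddPart_neg f) (hs n).1 (hs n).2
  obtain ⟨M, hM, hM'⟩ := exists_tendsto_of_near_mul (k := 4) (by norm_num)
    (a := fun n => RhoStar.evenPart f ((2 : ℝ) ^ n • x)) (C := 15 * ε) fun n => by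
      rw [pow_succ', mul_smul]
      exact hf.evenPart.near_quadruple_of_even (evenPart_neg f) (hs n).1 (hs n).2
  refine ⟨L, M, hL, hM, ?_⟩
  simp only [pow_zero, one_smul] at hL' hM'
  have hε := hf.nonneg
  refine (le_of_eq (congrArg norm ?_)).trans
    ((norm_sub_le_of_le (norm_add_le_of_le hL' hM') hf.norm_zero_le).trans (by linarith))
  rw [← oddPart_add_evenPart f x]
  abel

lemma NearOrthAdditive.exists_tendsto_of_corners [CompleteSpace Y]
    (hf : NearOrthAdditive ε f) {x w : X} {t t' : ℝ} (ht : 0 < t) (ht' : 0 < t')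
    (h : Corner (x + t • w) w) (h' : Corner (x - t' • w) w) :
    ∃ L M : Y, Tendsto (fun n : ℕ => ((2 : ℝ) ^ n)⁻¹ • RhoStar.oddPart f ((2 : ℝ) ^ n • x))
        atTop (𝓝 L) ∧
      Tendsto (fun n : ℕ => ((4 : ℝ) ^ n)⁻¹ • RhoStar.evenPart f ((2 : ℝ) ^ n • x))
        atTop (𝓝 M) ∧ ‖f x - f 0 - L - M‖ ≤ 68 / 3 * ε := by
  have hε := hf.nonneg
  have hline : ∀ a b : ℝ,
      ‖f ((a + b) • x) - f (a • x) - f (b • x) + f 0‖ ≤ 18 * ε := fun a b => by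
    simpa [add_smul] using hf.near_additive_plane ht ht' h h' a 0 b 0
  -- Near additivity keeps the even part bounded along the line, so it contributes nothing to either
  -- limit and `M = 0`.
  have hbdd : ∀ a : ℝ, ‖f 0 - RhoStar.evenPart f (a • x)‖ ≤ 9 * ε := fun a => by
    have e := hline a (-a)
    rw [add_neg_cancel, zero_smul, neg_smul] at e
    have e' : f 0 - RhoStar.evenPart f (a • x) =
        (2⁻¹ : ℝ) • (f 0 - f (a • x) - f (-(a • x)) + f 0) := by
      simp only [RhoStar.evenPart]
      module
    rw [e', norm_smul, Real.norm_of_nonneg (by norm_num)]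
    linarith
  obtain ⟨L, hL, hL'⟩ := exists_tendsto_of_near_mul one_lt_two
    (a := fun n : ℕ => f ((2 : ℝ) ^ n • x) - f 0) (C := 18 * ε) fun n => by
      have e := hline ((2 : ℝ) ^ n) ((2 : ℝ) ^ n)
      rw [← two_mul, ← pow_succ'] at e
      refine (le_of_eq (congrArg norm ?_)).trans e
      module
  have hz : ∀ k : ℝ, 1 < k → Tendsto (fun n : ℕ =>
      (k ^ n)⁻¹ • (f 0 - RhoStar.evenPart f ((2 : ℝ) ^ n • x))) atTop (𝓝 0) := fun k hk => by
    refine Tendsto.zero_smul_isBoundedUnder_le ?_ ?_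
    · exact tendsto_inv_atTop_zero.comp (tendsto_pow_atTop_atTop_of_one_lt hk)
    · exact isBoundedUnder_of ⟨9 * ε, fun n => hbdd _⟩
  have hc : Tendsto (fun n : ℕ => ((4 : ℝ) ^ n)⁻¹ • f 0) atTop (𝓝 ((0 : ℝ) • f 0)) :=
    (tendsto_inv_atTop_zero.comp
      (tendsto_pow_atTop_atTop_of_one_lt (by norm_num))).smul_const _
  refine ⟨L, 0, ?_, ?_, ?_⟩
  · have := hL.add (hz 2 one_lt_two)
    rw [add_zero] at this
    refine this.congr fun n => ?_
    rw [← smul_add, sub_add_sub_cancel]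
    congr 1
    rw [← oddPart_add_evenPart f ((2 : ℝ) ^ n • x), add_sub_cancel_right]
  · have := hc.sub (hz 4 (by norm_num))
    rw [zero_smul, sub_zero] at this
    refine this.congr fun n => ?_
    rw [← smul_sub, sub_sub_cancel]
  · simp only [pow_zero, one_smul] at hL'
    rw [sub_zero]
    linarith

lemma NearOrthAdditive.exists_tendsto [CompleteSpace Y] (hX : 2 ≤ Module.rank ℝ X)
    (hf : NearOrthAdditive ε f) (x : X) :
    ∃ L M : Y, Tendsto (fun n : ℕ => ((2 : ℝ) ^ n)⁻¹ • RhoStar.oddPart f ((2 : ℝ) ^ n • x))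
        atTop (𝓝 L) ∧
      Tendsto (fun n : ℕ => ((4 : ℝ) ^ n)⁻¹ • RhoStar.evenPart f ((2 : ℝ) ^ n • x))
        atTop (𝓝 M) ∧ ‖f x - f 0 - L - M‖ ≤ 68 / 3 * ε := by
  rcases eq_or_ne x 0 with rfl | hx
  · exact hf.exists_tendsto_of_orth (y := 0) (orth_zero_left 0)
      (by simpa using orth_zero_left (0 : X))
  obtain ⟨w, hw, hxw, -⟩ := exists_orth_basis hX hx 0
  rcases exists_orth_or_corners hx hw one_pos with ⟨t, h⟩ | ⟨t, s, ht, hs, hxt, hxs⟩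
  · rw [one_smul] at h
    exact hf.exists_tendsto_of_orth (hxw.smul_right t) h
  · exact hf.exists_tendsto_of_corners ht hs hxt hxs

/-- The limit of the rescalings of an approximately orthogonally additive mapping is
orthogonally additive. -/
lemma NearOrthAdditive.of_tendsto {g F : X → Y} {k : ℝ} (hk : 1 < k)
    (hg : NearOrthAdditive ε g)
    (h : ∀ x, Tendsto (fun n : ℕ => (k ^ n)⁻¹ • g ((2 : ℝ) ^ n • x)) atTop (𝓝 (F x))) :
    NearOrthAdditive 0 F := fun x y hxy => by
  refine le_of_tendsto_of_tendsto (((h (x + y)).sub (h x)).sub (h y)).norm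
    (g := fun n : ℕ => (k ^ n)⁻¹ * ε) ?_ (Eventually.of_forall fun n => ?_)
  · simpa using (tendsto_inv_atTop_zero.comp
      (tendsto_pow_atTop_atTop_of_one_lt hk)).mul_const ε
  · have hp : 0 ≤ (k ^ n)⁻¹ := inv_nonneg.2 (pow_nonneg (by linarith) n)
    beta_reduce
    rw [← smul_sub, ← smul_sub, norm_smul, Real.norm_of_nonneg hp, smul_add]
    exact mul_le_mul_of_nonneg_left (hg _ _ (hxy.smul _ _)) hp

lemma map_two_smul_of_tendsto {g F : X → Y} {k : ℝ} (hk : 1 < k)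
    (h : ∀ x, Tendsto (fun n : ℕ => (k ^ n)⁻¹ • g ((2 : ℝ) ^ n • x)) atTop (𝓝 (F x))) (x : X) :
    F ((2 : ℝ) • x) = k • F x := by
  refine tendsto_nhds_unique (h _)
    ((((tendsto_add_atTop_iff_nat 1).2 (h x)).const_smul k).congr fun n => ?_)
  rw [smul_smul, smul_smul, pow_succ, mul_inv, mul_comm (k ^ n)⁻¹,
    mul_inv_cancel_left₀ (by linarith), ← pow_succ]

end RhoStar
end

theorem mainTheorem9 {X Y : Type*}
    [NormedAddCommGroup X] [NormedSpace ℝ X]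
    [NormedAddCommGroup Y] [NormedSpace ℝ Y] [CompleteSpace Y]
    (hX : 2 ≤ Module.rank ℝ X)
    (f : X → Y) (ε : ℝ)
    (hf : ∀ x y : X, RhoStar.Orth x y → ‖f (x + y) - f x - f y‖ ≤ ε) :
    ∃! AQ : (X → Y) × (X → Y),
      RhoStar.IsAdditive AQ.1 ∧ RhoStar.IsQuadratic AQ.2 ∧
        ∀ x : X, ‖f x - f 0 - AQ.1 x - AQ.2 x‖ ≤ 68 / 3 * ε := by
  have hf' : RhoStar.NearOrthAdditive ε f := hf
  choose A Q hA hQ hAQ using hf'.exists_tendsto hX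
  have h4 : (1 : ℝ) < 4 := by norm_num
  have hAodd : ∀ x, A (-x) = -A x := fun x =>
    tendsto_nhds_unique (hA (-x)) ((hA x).neg.congr fun n => by
      rw [smul_neg, RhoStar.oddPart_neg, smul_neg])
  have hQeven : ∀ x, Q (-x) = Q x := fun x =>
    tendsto_nhds_unique (hQ (-x)) ((hQ x).congr fun n => by
      rw [smul_neg, RhoStar.evenPart_neg])
  have hA' : RhoStar.IsAdditive A := RhoStar.isAdditive_of_odd hX
    (hf'.oddPart.of_tendsto one_lt_two hA) hAodd
    (RhoStar.map_two_smul_of_tendsto one_lt_two hA)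
  have hQ' : RhoStar.IsQuadratic Q := RhoStar.isQuadratic_of_even hX
    (hf'.evenPart.of_tendsto h4 hQ) hQeven (RhoStar.map_two_smul_of_tendsto h4 hQ)
  refine ⟨(A, Q), ⟨hA', hQ', hAQ⟩, ?_⟩
  rintro ⟨A₁, Q₁⟩ ⟨hA₁, hQ₁, h₁⟩
  obtain ⟨e₁, e₂⟩ := RhoStar.additive_quadratic_unique hA₁ hA' hQ₁ hQ' h₁ hAQ
  exact Prod.ext e₁ e₂
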